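/- Flat conditional expressions are built from simple conditionals $(a|b)$, where $a,b$ are events of a probability space $(\Omega,\mathfrak M,\Pr)$, by the operations $\land$, $\lor$ and $\sim$. In the product space (PS) semantics an expression denotes a subset of $\Omega^{\infty}$: \[ [\![(a|b)]\!]=\bigcup_{j\ge 0}(\Omega\setminus b)^{j}\times(a\cap b)\times\Omega\times\Omega\times\cdots, \] $[\![e\land e']\!]=[\![e]\!]\cap[\![e']\!]$, $[\![e\lor e']\!]=[\![e]\!]\cup[\![e']\!]$, $[\![\sim e]\!]=\Omega^\infty\setminus[\![e]\!]$, and the PS probability of $e$ is the measure of $[\![e]\!]$ under the product measure $\Pr^{\infty}$. An $n$-ary conditional expression $e$ is an expression in $n$ simple conditionals $(a_1|b_1),\dots,(a_n|b_n)$; its length $m$ is the number of occurrences of simple conditionals and connectives in it. Theorem. There are a single algorithm and a polynomial $q$ such that for all $n$ and $m$, for every $n$-ary conditional expression $e$ of length $m$, every probability space $(\Omega,\mathfrak M,\Pr)$ and all events $a_1,b_1,\dots,a_n,b_n\in\mathfrak M$, the following holds. On input consisting of $n$, the expression $e$ (as a word over its $n$ arguments and the connectives) and the probabilities of the $4^n$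 atomic Boolean combinations of $a_1,b_1,\dots,a_n,b_n$, the algorithm halts after at most $q(\max(m,2^n))$ steps and outputs the PS probability of $e$. Here algorithms are programs for a random access machine which stores natural and real numbers in arrays with indirect addressing and performs, at unit cost each, addition and truncated subtraction of natural numbers, addition, subtraction, multiplication and division of real numbers, comparisons, and reading or writing of a memory cell; the only real constants in a program are $0$ and $1$. -/

import Mathlib

open MeasureTheory

namespace PSCond

/-! ### Flat conditional expressions and the product space semantics -/

/-- Flat conditional expressions whose simple conditionals are taken from `α`.
`FlatExpr (Set Ω × Set Ω)` are the expressions over events of `Ω`, the pair `(a, b)` being the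
simple conditional `(a | b)`; `FlatExpr (Fin n)` are the `n`-ary expressions, with the letter `i`
standing for the `i`-th of the `n` arguments `(a_i | b_i)`. -/
inductive FlatExpr (α : Type*) where
  | simple (x : α) : FlatExpr α
  | neg (e : FlatExpr α) : FlatExpr α
  | and (e f : FlatExpr α) : FlatExpr α
  | or (e f : FlatExpr α) : FlatExpr α

/-- Substitution of simple conditionals for the arguments of an expression. -/
def FlatExpr.map {α β : Type*} (g : α → β) : FlatExpr α → FlatExpr β
  | .simple x => .simple (g x)
  | .neg e => .neg (e.map g)
  | .and e f => .and (e.map g) (f.map g)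
  | .or e f => .or (e.map g) (f.map g)

/-- The length of an expression: the number of occurrences of simple conditionals and
connectives. -/
def FlatExpr.length {α : Type*} : FlatExpr α → ℕ
  | .simple _ => 1
  | .neg e => e.length + 1
  | .and e f => e.length + f.length + 1
  | .or e f => e.length + f.length + 1

/-- The product space semantics: an expression over events of `Ω` denotes a set of infinite
sequences of elements of `Ω`. The simple conditional `(a | b)` denotes the union over `j` of the
cylinders `(Ω \ b)^j × (b ∩ a) × Ω × Ω × ⋯`. -/
def FlatExpr.ps {Ω : Type*} : FlatExpr (Set Ω × Set Ω) → Set (ℕ → Ω)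
  | .simple x => ⋃ j : ℕ, {w | (∀ k < j, w k ∈ x.2ᶜ) ∧ w j ∈ x.2 ∩ x.1}
  | .neg e => e.psᶜ
  | .and e f => e.ps ∩ f.ps
  | .or e f => e.ps ∪ f.ps

/-- The PS probability of an expression: the measure of its denotation under the countable
power of the probability measure `μ`. -/
noncomputable def FlatExpr.psProb {Ω : Type*} [MeasurableSpace Ω] (μ : Measure Ω)
    [IsProbabilityMeasure μ] (e : FlatExpr (Set Ω × Set Ω)) : ℝ :=
  (Measure.infinitePi (fun _ : ℕ => μ)).real e.ps

/-! ### A random access machine with real arithmetic at unit cost -/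

/-- The memory: countably many named arrays of natural numbers and countably many named arrays
of real numbers (a program mentions only finitely many names). -/
structure State where
  nat : ℕ → ℕ → ℕ
  real : ℕ → ℕ → ℝ

/-- Integer expressions (counters, addresses): literals, the entry of the array `k` at a computed
index, addition and truncated subtraction. -/
inductive NatExp where
  | lit (c : ℕ) : NatExp
  | get (k : ℕ) (i : NatExp) : NatExp
  | add (e f : NatExp) : NatExp
  | sub (e f : NatExp) : NatExp

def NatExp.eval (s : State) : NatExp → ℕ
  | .lit c => c
  | .get k i => s.nat k (i.eval s)
  | .add e f => e.eval s + f.eval s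
  | .sub e f => e.eval s - f.eval s

/-- Every operation has unit cost. -/
def NatExp.cost : NatExp → ℕ
  | .lit _ => 1
  | .get _ i => i.cost + 1
  | .add e f => e.cost + f.cost + 1
  | .sub e f => e.cost + f.cost + 1

/-- Real expressions: the constants 0 and 1, the entry of the array `k` at a computed index, and
the four arithmetical operations. -/
inductive RealExp where
  | zero : RealExp
  | one : RealExp
  | get (k : ℕ) (i : NatExp) : RealExp
  | add (e f : RealExp) : RealExp
  | sub (e f : RealExp) : RealExp
  | mul (e f : RealExp) : RealExp
  | div (e f : RealExp) : RealExp

/-- Division by zero returns zero; as a program can test whether a number is zero, this adds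
nothing to the power of the machine. -/
noncomputable def RealExp.eval (s : State) : RealExp → ℝ
  | .zero => 0
  | .one => 1
  | .get k i => s.real k (i.eval s)
  | .add e f => e.eval s + f.eval s
  | .sub e f => e.eval s - f.eval s
  | .mul e f => e.eval s * f.eval s
  | .div e f => e.eval s / f.eval s

/-- Every operation has unit cost. -/
def RealExp.cost : RealExp → ℕ
  | .zero => 1
  | .one => 1
  | .get _ i => i.cost + 1
  | .add e f => e.cost + f.cost + 1
  | .sub e f => e.cost + f.cost + 1
  | .mul e f => e.cost + f.cost + 1
  | .div e f => e.cost + f.cost + 1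

/-- Comparisons of two natural numbers or of two real numbers. -/
inductive Test where
  | natLt (e f : NatExp) : Test
  | natEq (e f : NatExp) : Test
  | realLt (e f : RealExp) : Test
  | realEq (e f : RealExp) : Test

def Test.holds (s : State) : Test → Prop
  | .natLt e f => e.eval s < f.eval s
  | .natEq e f => e.eval s = f.eval s
  | .realLt e f => e.eval s < f.eval s
  | .realEq e f => e.eval s = f.eval s

def Test.cost : Test → ℕ
  | .natLt e f => e.cost + f.cost + 1
  | .natEq e f => e.cost + f.cost + 1
  | .realLt e f => e.cost + f.cost + 1
  | .realEq e f => e.cost + f.cost + 1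

/-- Programs. `setNat k i e` stores the value of `e` in the array `k` at the index `i`, and
similarly for `setReal`. -/
inductive Program where
  | skip : Program
  | setNat (k : ℕ) (i e : NatExp) : Program
  | setReal (k : ℕ) (i : NatExp) (e : RealExp) : Program
  | seq (P Q : Program) : Program
  | cond (b : Test) (P Q : Program) : Program
  | loop (b : Test) (P : Program) : Program

def State.setNat (s : State) (k i v : ℕ) : State :=
  { s with nat := fun k' i' => if k' = k ∧ i' = i then v else s.nat k' i' }

noncomputable def State.setReal (s : State) (k i : ℕ) (v : ℝ) : State :=
  { s with real := fun k' i' => if k' = k ∧ i' = i then v else s.real k' i' }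

/-- `Exec P s s' t`: started in the state `s`, the program `P` halts after exactly `t` elementary
operations, in the state `s'`. The program `loop b P` repeats `P` as long as `b` holds. -/
inductive Exec : Program → State → State → ℕ → Prop
  | skip (s : State) : Exec .skip s s 1
  | setNat (k : ℕ) (i e : NatExp) (s : State) :
      Exec (.setNat k i e) s (s.setNat k (i.eval s) (e.eval s)) (i.cost + e.cost + 1)
  | setReal (k : ℕ) (i : NatExp) (e : RealExp) (s : State) :
      Exec (.setReal k i e) s (s.setReal k (i.eval s) (e.eval s)) (i.cost + e.cost + 1)
  | seq {P Q : Program} {s s' s'' : State} {t t' : ℕ} :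
      Exec P s s' t → Exec Q s' s'' t' → Exec (.seq P Q) s s'' (t + t')
  | condTrue {b : Test} {P Q : Program} {s s' : State} {t : ℕ} :
      b.holds s → Exec P s s' t → Exec (.cond b P Q) s s' (b.cost + t)
  | condFalse {b : Test} {P Q : Program} {s s' : State} {t : ℕ} :
      ¬ b.holds s → Exec Q s s' t → Exec (.cond b P Q) s s' (b.cost + t)
  | loopTrue {b : Test} {P : Program} {s s' s'' : State} {t t' : ℕ} :
      b.holds s → Exec P s s' t → Exec (.loop b P) s' s'' t' →
        Exec (.loop b P) s s'' (b.cost + t + t')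
  | loopFalse {b : Test} {P : Program} {s : State} :
      ¬ b.holds s → Exec (.loop b P) s s b.cost

/-- The machine is deterministic: the final state and the running time are functions of the
program and the initial state. -/
theorem Exec.deterministic {P : Program} {s s₁ s₂ : State} {t₁ t₂ : ℕ}
    (h₁ : Exec P s s₁ t₁) (h₂ : Exec P s s₂ t₂) : s₁ = s₂ ∧ t₁ = t₂ := by
  induction h₁ generalizing s₂ t₂ with
  | skip | setNat | setReal => cases h₂; exact ⟨rfl, rfl⟩
  | seq _ _ ih ih' =>
    cases h₂ with
    | seq k k' =>
      obtain ⟨rfl, rfl⟩ := ih k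
      obtain ⟨rfl, rfl⟩ := ih' k'
      exact ⟨rfl, rfl⟩
  | condTrue hb _ ih =>
    cases h₂ with
    | condTrue _ k => obtain ⟨rfl, rfl⟩ := ih k; exact ⟨rfl, rfl⟩
    | condFalse hn _ => exact absurd hb hn
  | condFalse hb _ ih =>
    cases h₂ with
    | condTrue hn _ => exact absurd hn hb
    | condFalse _ k => obtain ⟨rfl, rfl⟩ := ih k; exact ⟨rfl, rfl⟩
  | loopTrue hb _ _ ih ih' =>
    cases h₂ with
    | loopTrue _ k k' =>
      obtain ⟨rfl, rfl⟩ := ih k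
      obtain ⟨rfl, rfl⟩ := ih' k'
      exact ⟨rfl, rfl⟩
    | loopFalse hn => exact absurd hb hn
  | loopFalse hb =>
    cases h₂ with
    | loopTrue hn _ _ => exact absurd hn hb
    | loopFalse _ => exact ⟨rfl, rfl⟩

/-! ### The input of the algorithm -/

/-- An `n`-ary expression as a word, in reverse Polish notation. The connectives are the letters
0, 1, 2, and the `i`-th argument is the letter `i + 3`. -/
def FlatExpr.word {n : ℕ} : FlatExpr (Fin n) → List ℕ
  | .simple i => [(i : ℕ) + 3]
  | .neg e => e.word ++ [0]
  | .and e f => e.word ++ f.word ++ [1]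
  | .or e f => e.word ++ f.word ++ [2]

/-- For `j < 4 ^ n`, the `j`-th atomic Boolean combination of the events
`a_0, b_0, …, a_(n-1), b_(n-1)`: the binary digits of `j` in the places `2 i` and `2 i + 1` tell
whether `a_i` and `b_i` happen. -/
def atom {Ω : Type*} {n : ℕ} (a b : Fin n → Set Ω) (j : ℕ) : Set Ω :=
  {ω | ∀ i : Fin n, (ω ∈ a i ↔ j.testBit (2 * (i : ℕ)) = true) ∧
    (ω ∈ b i ↔ j.testBit (2 * (i : ℕ) + 1) = true)}

/-- The initial state of the machine on the `n`-ary expression `e` and the table `p` of the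
probabilities of the `4 ^ n` atomic Boolean combinations of its arguments. The integer array `0`
holds `n` and the length of the word of `e`, the integer array `1` holds this word, and the real
array `0` holds the table. All other entries are zero. -/
noncomputable def inputState {n : ℕ} (e : FlatExpr (Fin n)) (p : ℕ → ℝ) : State where
  nat k i :=
    if k = 0 then (if i = 0 then n else if i = 1 then e.word.length else 0)
    else if k = 1 then e.word.getD i 0
    else 0
  real k i := if k = 0 ∧ i < 4 ^ n then p i else 0

end PSCond

open PSCond

/-!
Observe the points of a sequence one at a time and record, for every conditional `(a_i | b_i)`,
whether it is still undecided and otherwise its truth value, which is settled by the first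
observation in `b_i`. The probability that the expression is true given the current record `r` is
the average, over the atom of the next observation, of the same probability given the updated
record. If `r` changes with positive probability, this equation can be solved for the probability
given `r` in terms of strictly larger records. Otherwise `r` almost surely never changes, undecided
conditionals stay undecided and hence are false, and the probability is the truth value of the
expression. There are `3 ^ n` records; coding them by `n` base four digits, like the atoms, makes
the codes grow with the records, so that a loop over the `4 ^ n` codes in descending order solves
all equations by one division each and ends with the empty record.
-/

namespace PSCond

section Semantics

variable {α Ω : Type*}

/-- The truth value of an expression under an assignment of truth values to its letters. -/
def FlatExpr.eval (v : α → Bool) : FlatExpr α → Bool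
  | .simple x => v x
  | .neg e => !e.eval v
  | .and e f => e.eval v && f.eval v
  | .or e f => e.eval v || f.eval v

open Classical in
/-- The truth value of the simple conditional `x = (a, b)` at a sequence of observations, in the
product space semantics. -/
noncomputable def psValue (x : Set Ω × Set Ω) (w : ℕ → Ω) : Bool :=
  decide (w ∈ (FlatExpr.simple x).ps)

theorem psValue_eq_true_iff {x : Set Ω × Set Ω} {w : ℕ → Ω} :
    psValue x w = true ↔ ∃ j, (∀ k < j, w k ∉ x.2) ∧ w j ∈ x.2 ∧ w j ∈ x.1 := by
  simp only [psValue, decide_eq_true_eq]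
  simp [FlatExpr.ps]

theorem FlatExpr.mem_ps_map (g : α → Set Ω × Set Ω) (e : FlatExpr α) (w : ℕ → Ω) :
    w ∈ (e.map g).ps ↔ e.eval (fun i => psValue (g i) w) = true := by
  induction e with
  | simple => simp only [map, eval, psValue, decide_eq_true_eq]
  | neg _ ih =>
    simp only [map, ps, eval, Set.mem_compl_iff, ih, Bool.not_eq_true, Bool.not_eq_true']
  | and _ _ ih ih' => simp only [map, ps, eval, Set.mem_inter_iff, ih, ih', Bool.and_eq_true]
  | or _ _ ih ih' => simp only [map, ps, eval, Set.mem_union, ih, ih', Bool.or_eq_true]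

theorem FlatExpr.measurable_eval {β : Type*} [MeasurableSpace β] {v : β → α → Bool}
    (hv : ∀ i, Measurable fun w => v w i) (e : FlatExpr α) : Measurable fun w => e.eval (v w) := by
  induction e with
  | simple i => exact hv i
  | neg _ ih => exact (measurable_of_countable _).comp ih
  | and _ _ ih ih' =>
    exact (measurable_of_countable fun p : Bool × Bool => p.1 && p.2).comp (ih.prodMk ih')
  | or _ _ ih ih' =>
    exact (measurable_of_countable fun p : Bool × Bool => p.1 || p.2).comp (ih.prodMk ih')

theorem measurable_psValue [MeasurableSpace Ω] {x : Set Ω × Set Ω} (ha : MeasurableSet x.1)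
    (hb : MeasurableSet x.2) : Measurable (psValue x) := by
  refine measurable_to_bool ?_
  have h : psValue x ⁻¹' {true} =
      ⋃ j : ℕ, (⋂ k < j, (· k) ⁻¹' x.2ᶜ) ∩ (· j) ⁻¹' (x.2 ∩ x.1) := by
    ext w
    simp [psValue_eq_true_iff]
  rw [h]
  exact .iUnion fun j => .inter
    (.iInter fun k => .iInter fun _ => measurable_pi_apply k hb.compl)
    (measurable_pi_apply j (hb.inter ha))

/-- The sequence `ω, w 0, w 1, …`. -/
def consSeq (p : Ω × (ℕ → Ω)) : ℕ → Ω
  | 0 => p.1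
  | k + 1 => p.2 k

open Classical in
/-- What a single observation tells about the conditional `x = (a, b)`: nothing unless `b`
happens, and otherwise whether `a` happens. -/
noncomputable def verdict (x : Set Ω × Set Ω) (ω : Ω) : Option Bool :=
  if ω ∈ x.2 then some (decide (ω ∈ x.1)) else none

theorem psValue_consSeq (x : Set Ω × Set Ω) (ω : Ω) (w : ℕ → Ω) :
    psValue x (consSeq (ω, w)) = (verdict x ω).getD (psValue x w) := by
  rw [Bool.eq_iff_iff, psValue_eq_true_iff, ← Nat.or_exists_add_one]
  simp only [Nat.forall_lt_succ_left]
  by_cases hω : ω ∈ x.2 <;> simp [verdict, hω, consSeq, psValue_eq_true_iff]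

theorem measurable_consSeq [MeasurableSpace Ω] : Measurable (consSeq : Ω × (ℕ → Ω) → ℕ → Ω) := by
  refine measurable_pi_lambda _ fun k => ?_
  cases k with
  | zero => exact measurable_fst
  | succ k => exact (measurable_pi_apply k).comp measurable_snd

theorem consSeq_preimage_pi (s : Finset ℕ) (t : ℕ → Set Ω) :
    consSeq ⁻¹' Set.pi (s : Set ℕ) t = (if 0 ∈ s then t 0 else Set.univ) ×ˢ
      Set.pi (s.preimage Nat.succ Nat.succ_injective.injOn : Set ℕ) fun k => t (k + 1) := by
  ext ⟨ω, w⟩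
  rw [Set.mem_preimage, Set.mem_pi, ← Nat.and_forall_add_one]
  by_cases h : 0 ∈ s <;> simp [h, consSeq]

theorem prod_eq_zero_mul_succ {M : Type*} [CommMonoid M] (s : Finset ℕ) (f : ℕ → M) :
    ∏ k ∈ s, f k = (if 0 ∈ s then f 0 else 1) *
      ∏ k ∈ s.preimage Nat.succ Nat.succ_injective.injOn, f (k + 1) := by
  classical
  rw [Finset.prod_preimage' Nat.succ s Nat.succ_injective.injOn f,
    ← Finset.prod_filter_mul_prod_filter_not s (· = 0), Finset.filter_eq']
  congr 1
  · split_ifs <;> simp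
  · exact Finset.prod_congr (Finset.filter_congr fun k _ => by simp [Nat.pos_iff_ne_zero])
      fun _ _ => rfl

theorem map_consSeq_prod_infinitePi [MeasurableSpace Ω] (μ : ℕ → Measure Ω)
    [∀ k, IsProbabilityMeasure (μ k)] :
    ((μ 0).prod (Measure.infinitePi fun k => μ (k + 1))).map consSeq = Measure.infinitePi μ := by
  refine Measure.eq_infinitePi _ fun s t ht => ?_
  rw [Measure.map_apply measurable_consSeq (.pi s.countable_toSet fun i _ => ht i),
    consSeq_preimage_pi, Measure.prod_prod, Measure.infinitePi_pi _ fun i _ => ht _,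
    prod_eq_zero_mul_succ s]
  split_ifs <;> simp

/-- The probability that the expression `e` in the conditionals `g i` is true when the `i`-th of
them has been decided as recorded in `r i`, where `none` stands for undecided. -/
noncomputable def recordProb [MeasurableSpace Ω] (μ : Measure Ω) [IsProbabilityMeasure μ]
    (g : α → Set Ω × Set Ω) (e : FlatExpr α) (r : α → Option Bool) : ℝ :=
  (Measure.infinitePi fun _ : ℕ => μ).real {w | e.eval (fun i => (r i).getD (psValue (g i) w))}

variable [MeasurableSpace Ω] (μ : Measure Ω) [IsProbabilityMeasure μ] {g : α → Set Ω × Set Ω}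
  (e : FlatExpr α) (r : α → Option Bool)

theorem recordProb_none (g : α → Set Ω × Set Ω) :
    recordProb μ g e (fun _ => none) = (e.map g).psProb μ :=
  congrArg _ <| Set.ext fun w => (e.mem_ps_map g w).symm

theorem measurableSet_eval_record (ha : ∀ i, MeasurableSet (g i).1)
    (hb : ∀ i, MeasurableSet (g i).2) :
    MeasurableSet {w : ℕ → Ω | e.eval fun i => (r i).getD (psValue (g i) w)} := by
  refine e.measurable_eval (fun i => ?_) (.singleton true)
  cases r i with
  | none => exact measurable_psValue (ha i) (hb i)
  | some => exact measurable_const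

theorem recordProb_eq_integral (ha : ∀ i, MeasurableSet (g i).1)
    (hb : ∀ i, MeasurableSet (g i).2) :
    recordProb μ g e r = ∫ ω, recordProb μ g e (fun i => (r i).or (verdict (g i) ω)) ∂μ := by
  have hm := measurableSet_eval_record e r ha hb
  have hsection (ω : Ω) : Prod.mk ω ⁻¹' (consSeq ⁻¹' {w : ℕ → Ω |
      e.eval fun i => (r i).getD (psValue (g i) w)}) =
      {w | e.eval fun i => ((r i).or (verdict (g i) ω)).getD (psValue (g i) w)} := by
    simp only [Set.preimage_ofPred_eq, psValue_consSeq, Option.getD_or]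
  rw [recordProb, ← map_consSeq_prod_infinitePi, map_measureReal_apply measurable_consSeq hm,
    measureReal_def, Measure.prod_apply (measurable_consSeq hm), ← integral_toReal
      (measurable_measure_prodMk_left (measurable_consSeq hm)).aemeasurable
      (ae_of_all _ fun ω => measure_lt_top _ _)]
  simp only [hsection]
  rfl

theorem recordProb_of_ae_eq (h : ∀ᵐ ω ∂μ, ∀ i, (r i).or (verdict (g i) ω) = r i) :
    recordProb μ g e r = (e.eval fun i => (r i).getD false).toNat := by
  have hae : ∀ᵐ w ∂Measure.infinitePi fun _ : ℕ => μ, ∀ k, ∀ i,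
      (r i).or (verdict (g i) (w k)) = r i :=
    ae_all_iff.2 fun k =>
      (measurePreserving_eval_infinitePi (fun _ : ℕ => μ) k).quasiMeasurePreserving.ae h
  have hvalue : ∀ᵐ w ∂Measure.infinitePi fun _ : ℕ => μ,
      (fun i => (r i).getD (psValue (g i) w)) = fun i => (r i).getD false := by
    filter_upwards [hae] with w hw
    funext i
    cases hi : r i with
    | some => rfl
    | none =>
      rw [Option.getD_none, Option.getD_none, ← Bool.not_eq_true, psValue_eq_true_iff]
      rintro ⟨j, -, hj, -⟩
      simpa [hi, verdict, hj] using hw j i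
  have hset : {w : ℕ → Ω | e.eval fun i => (r i).getD (psValue (g i) w)} =ᵐ[Measure.infinitePi
      fun _ : ℕ => μ] {_w | e.eval fun i => (r i).getD false} := by
    filter_upwards [hvalue] with w hw
    exact congrArg (fun v => e.eval v = true) hw
  rw [recordProb, measureReal_congr hset]
  cases e.eval fun i => (r i).getD false <;> simp

end Semantics

section Records

/-- The `i`-th base four digit of `x`. -/
def digit (x i : ℕ) : ℕ := x / 4 ^ i % 4

theorem digit_lt (x i : ℕ) : digit x i < 4 := Nat.mod_lt _ (by norm_num)

theorem digit_zero_left (i : ℕ) : digit 0 i = 0 := by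
  rw [digit, Nat.zero_div, Nat.zero_mod]

theorem four_mul_div_pow_succ_add_digit (x i : ℕ) :
    4 * (x / 4 ^ (i + 1)) + digit x i = x / 4 ^ i := by
  rw [digit, pow_succ, ← Nat.div_div_eq_div_mul]
  exact Nat.div_add_mod _ 4

theorem sum_digit {n x : ℕ} (hx : x < 4 ^ n) : ∑ i : Fin n, digit x i * 4 ^ (i : ℕ) = x :=
  congrArg Fin.val (finFunctionFinEquiv.right_inv (⟨x, hx⟩ : Fin (4 ^ n)))

theorem sum_mul_four_pow_lt {n : ℕ} {d : Fin n → ℕ} (hd : ∀ i, d i < 4) :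
    ∑ i, d i * 4 ^ (i : ℕ) < 4 ^ n :=
  (finFunctionFinEquiv fun i => (⟨d i, hd i⟩ : Fin 4)).is_lt

theorem digit_sum {n : ℕ} {d : Fin n → ℕ} (hd : ∀ i, d i < 4) (i : Fin n) :
    digit (∑ i, d i * 4 ^ (i : ℕ)) i = d i :=
  congrArg Fin.val (congrFun (finFunctionFinEquiv.left_inv fun i => (⟨d i, hd i⟩ : Fin 4)) i)

/-- The verdict encoded by a base four digit, which is also the digit of an atom: its bit of
weight 2 tells whether `b` happens, and its bit of weight 1 whether `a` happens. -/
def digitVerdict (d : ℕ) : Option Bool :=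
  if d < 2 then none else some (decide (d = 3))

/-- The record whose entries are encoded by the base four digits of `x`. -/
def decode (n x : ℕ) (i : Fin n) : Option Bool := digitVerdict (digit x i)

theorem decode_zero (n : ℕ) : decode n 0 = fun _ => none := by
  funext i
  rw [decode, digit_zero_left]
  rfl

/-- The digit `d` of a record after the observation of an atom with the digit `d'`. The maximum
only serves to let the digit grow, as `0` and `1` both mean undecided. -/
def stepDigit (d d' : ℕ) : ℕ := if d < 2 then max d d' else d

theorem stepDigit_lt {d d' : ℕ} (h : d < 4) (h' : d' < 4) : stepDigit d d' < 4 := by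
  unfold stepDigit; split_ifs <;> omega

theorem le_stepDigit (d d' : ℕ) : d ≤ stepDigit d d' := by
  unfold stepDigit; split_ifs <;> omega

theorem digitVerdict_stepDigit (d d' : ℕ) :
    digitVerdict (stepDigit d d') = (digitVerdict d).or (digitVerdict d') := by
  unfold digitVerdict stepDigit
  grind

/-- The code of the record `x` after the observation of a point of the `j`-th atom. -/
def step (n x j : ℕ) : ℕ := ∑ i : Fin n, stepDigit (digit x i) (digit j i) * 4 ^ (i : ℕ)

theorem step_lt (n x j : ℕ) : step n x j < 4 ^ n :=
  sum_mul_four_pow_lt fun i => stepDigit_lt (digit_lt x i) (digit_lt j i)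

theorem digit_step {n : ℕ} (x j : ℕ) (i : Fin n) :
    digit (step n x j) i = stepDigit (digit x i) (digit j i) :=
  digit_sum (fun i : Fin n => stepDigit_lt (digit_lt x i) (digit_lt j i)) i

theorem le_step {n x : ℕ} (hx : x < 4 ^ n) (j : ℕ) : x ≤ step n x j :=
  (sum_digit hx).symm.trans_le <|
    Finset.sum_le_sum fun _ _ => Nat.mul_le_mul_right _ (le_stepDigit _ _)

theorem decode_step {n : ℕ} (x j : ℕ) (i : Fin n) :
    decode n (step n x j) i = (decode n x i).or (decode n j i) := by
  rw [decode, digit_step, digitVerdict_stepDigit, decode, decode]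

/-- The probability that the next observation changes the record `x`, if `p j` is the probability
of the `j`-th atom. -/
noncomputable def leaveProb (n : ℕ) (p : ℕ → ℝ) (x : ℕ) : ℝ :=
  ∑ j ∈ Finset.range (4 ^ n), if step n x j = x then 0 else p j

/-- The equations for the probabilities `F x` that `e` is true after the record `x`. They
determine `F`, as a changed record has a larger code. -/
def IsSolution {n : ℕ} (e : FlatExpr (Fin n)) (p F : ℕ → ℝ) : Prop :=
  ∀ x, F x = if leaveProb n p x = 0 then ((e.eval fun i => (decode n x i).getD false).toNat : ℝ)
    else (∑ j ∈ Finset.range (4 ^ n), if step n x j = x then 0 else p j * F (step n x j)) /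
      leaveProb n p x

theorem leaveProb_mul_eq_sum {n x : ℕ} {p F : ℕ → ℝ}
    (hp : ∑ j ∈ Finset.range (4 ^ n), p j = 1)
    (hF : F x = ∑ j ∈ Finset.range (4 ^ n), p j * F (step n x j)) :
    leaveProb n p x * F x =
      ∑ j ∈ Finset.range (4 ^ n), if step n x j = x then 0 else p j * F (step n x j) := by
  have hstay : ∑ j ∈ Finset.range (4 ^ n), p j * (F (step n x j) - F x) = 0 := by
    rw [← sub_eq_zero.2 hF.symm]
    simp only [mul_sub, Finset.sum_sub_distrib, ← Finset.sum_mul, hp, one_mul]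
  rw [eq_comm, ← sub_eq_zero, leaveProb, Finset.sum_mul, ← Finset.sum_sub_distrib]
  refine (Finset.sum_congr rfl fun j _ => ?_).trans hstay
  split_ifs with h
  · rw [h]; ring
  · ring

end Records

section Atoms

variable {Ω : Type*} {n : ℕ} {a b : Fin n → Set Ω}

open Classical in
/-- The index of the atom which contains `ω`. -/
noncomputable def atomIndex (a b : Fin n → Set Ω) (ω : Ω) : ℕ :=
  ∑ i : Fin n, ((if ω ∈ a i then 1 else 0) + if ω ∈ b i then 2 else 0) * 4 ^ (i : ℕ)

theorem mem_atom_iff_digit {j : ℕ} {ω : Ω} : ω ∈ atom a b j ↔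
    ∀ i : Fin n, (ω ∈ a i ↔ digit j i % 2 = 1) ∧ (ω ∈ b i ↔ 2 ≤ digit j i) := by
  refine forall_congr' fun i => ?_
  have h4 : (2 : ℕ) ^ (2 * (i : ℕ)) = 4 ^ (i : ℕ) := pow_mul 2 2 _
  rw [Nat.testBit_eq_decide_div_mod_eq, Nat.testBit_eq_decide_div_mod_eq, pow_succ,
    ← Nat.div_div_eq_div_mul, h4, decide_eq_true_eq, decide_eq_true_eq, digit]
  refine and_congr (iff_congr .rfl ?_) (iff_congr .rfl ?_) <;> omega

theorem mem_atom_iff_atomIndex_eq {j : ℕ} (hj : j < 4 ^ n) {ω : Ω} :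
    ω ∈ atom a b j ↔ atomIndex a b ω = j := by
  classical
  have hlt (i : Fin n) : ((if ω ∈ a i then 1 else 0) + if ω ∈ b i then 2 else 0) < 4 := by
    split_ifs <;> norm_num
  rw [mem_atom_iff_digit]
  constructor
  · intro h
    conv_rhs => rw [← sum_digit hj]
    refine Finset.sum_congr rfl fun i _ => congrArg (· * _) ?_
    have := digit_lt j i
    obtain ⟨ha, hb⟩ := h i
    split_ifs <;> grind
  · rintro rfl i
    rw [atomIndex, digit_sum hlt]
    split_ifs <;> simp [*]

theorem atomIndex_lt (ω : Ω) : atomIndex a b ω < 4 ^ n := by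
  classical
  exact sum_mul_four_pow_lt fun i => by split_ifs <;> norm_num

theorem decode_of_mem_atom {j : ℕ} {ω : Ω} (h : ω ∈ atom a b j) (i : Fin n) :
    decode n j i = verdict (a i, b i) ω := by
  obtain ⟨ha, hb⟩ := mem_atom_iff_digit.1 h i
  have hlt := digit_lt j i
  rw [decode, digitVerdict, verdict]
  by_cases hbi : 2 ≤ digit j i
  · have hai : digit j i = 3 ↔ ω ∈ a i := by rw [ha]; omega
    rw [if_neg hbi.not_gt, if_pos (hb.2 hbi), decide_eq_decide.2 hai]
  · rw [if_pos (not_le.1 hbi), if_neg (hb.not.2 hbi)]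

variable [MeasurableSpace Ω]

theorem measurableSet_atom (ha : ∀ i, MeasurableSet (a i)) (hb : ∀ i, MeasurableSet (b i))
    (j : ℕ) : MeasurableSet (atom a b j) := by
  have h : atom a b j = ⋂ i, {ω | (ω ∈ a i ↔ j.testBit (2 * (i : ℕ)) = true) ∧
      (ω ∈ b i ↔ j.testBit (2 * (i : ℕ) + 1) = true)} := Set.ofPred_forall _
  rw [h]
  exact .iInter fun i => .inter ((ha i).iff (.const _)) ((hb i).iff (.const _))

variable {μ : Measure Ω} [IsProbabilityMeasure μ]

theorem integral_eq_sum_atom (ha : ∀ i, MeasurableSet (a i)) (hb : ∀ i, MeasurableSet (b i))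
    {f : Ω → ℝ} {c : ℕ → ℝ} (hf : ∀ j, ∀ ω ∈ atom a b j, f ω = c j) :
    ∫ ω, f ω ∂μ = ∑ j ∈ Finset.range (4 ^ n), μ.real (atom a b j) * c j := by
  have hcover : ⋃ j ∈ Finset.range (4 ^ n), atom a b j = Set.univ :=
    Set.eq_univ_of_forall fun ω => Set.mem_biUnion (Finset.mem_range.2 (atomIndex_lt ω))
      ((mem_atom_iff_atomIndex_eq (atomIndex_lt ω)).2 rfl)
  have hdisj : (Finset.range (4 ^ n) : Set ℕ).Pairwise (Function.onFun Disjoint (atom a b)) :=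
    fun j hj k hk hne => Set.disjoint_left.2 fun ω hω hω' => hne <|
      ((mem_atom_iff_atomIndex_eq (Finset.mem_range.1 hj)).1 hω).symm.trans
        ((mem_atom_iff_atomIndex_eq (Finset.mem_range.1 hk)).1 hω')
  have hm := measurableSet_atom ha hb
  rw [← setIntegral_univ, ← hcover, integral_biUnion_finset _ (fun j _ => hm j) hdisj fun j _ =>
    (integrableOn_const (C := c j)).congr_fun (fun ω hω => (hf j ω hω).symm) (hm j)]
  exact Finset.sum_congr rfl fun j _ => by
    rw [setIntegral_congr_fun (hm j) (hf j), setIntegral_const, smul_eq_mul]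

theorem sum_measureReal_atom (ha : ∀ i, MeasurableSet (a i)) (hb : ∀ i, MeasurableSet (b i)) :
    ∑ j ∈ Finset.range (4 ^ n), μ.real (atom a b j) = 1 := by
  simpa using (integral_eq_sum_atom (μ := μ) ha hb (f := fun _ => 1) (c := fun _ => 1)
    fun _ _ _ => rfl).symm

theorem recordProb_decode_eq_sum (ha : ∀ i, MeasurableSet (a i))
    (hb : ∀ i, MeasurableSet (b i)) (e : FlatExpr (Fin n)) (x : ℕ) :
    recordProb μ (fun i => (a i, b i)) e (decode n x) = ∑ j ∈ Finset.range (4 ^ n),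
      μ.real (atom a b j) * recordProb μ (fun i => (a i, b i)) e (decode n (step n x j)) := by
  rw [recordProb_eq_integral μ e _ ha hb]
  refine integral_eq_sum_atom ha hb fun j ω hω => congrArg _ (funext fun i => ?_)
  rw [decode_step, decode_of_mem_atom hω]

theorem ae_or_verdict_eq_of_leaveProb_eq_zero {x : ℕ}
    (h : leaveProb n (fun j => μ.real (atom a b j)) x = 0) :
    ∀ᵐ ω ∂μ, ∀ i, (decode n x i).or (verdict (a i, b i) ω) = decode n x i := by
  have hnull : ∀ j ∈ Finset.range (4 ^ n), step n x j ≠ x → ∀ᵐ ω ∂μ, ω ∉ atom a b j := by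
    intro j hj hne
    have hj := (Finset.sum_eq_zero_iff_of_nonneg fun j _ => by split_ifs <;> positivity).1 h j hj
    rw [if_neg hne] at hj
    exact measure_eq_zero_iff_ae_notMem.1 ((measureReal_eq_zero_iff).1 hj)
  filter_upwards [(Finset.eventually_all _).2 fun j hj => Filter.eventually_imp_distrib_left.2
    (hnull j hj)] with ω hω i
  have hmem := (mem_atom_iff_atomIndex_eq (a := a) (b := b) (atomIndex_lt ω)).2 rfl
  have hstep : step n x (atomIndex a b ω) = x := by
    by_contra hne
    exact hω _ (Finset.mem_range.2 (atomIndex_lt ω)) hne hmem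
  rw [← decode_of_mem_atom hmem, ← decode_step, hstep]

theorem isSolution_recordProb (ha : ∀ i, MeasurableSet (a i)) (hb : ∀ i, MeasurableSet (b i))
    (e : FlatExpr (Fin n)) : IsSolution e (fun j => μ.real (atom a b j)) fun x =>
      recordProb μ (fun i => (a i, b i)) e (decode n x) := by
  intro x
  split_ifs with h
  · exact recordProb_of_ae_eq μ e _ (ae_or_verdict_eq_of_leaveProb_eq_zero h)
  · rw [eq_div_iff h, mul_comm]
    exact leaveProb_mul_eq_sum (F := fun x => recordProb μ (fun i => (a i, b i)) e (decode n x))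
      (sum_measureReal_atom ha hb) (recordProb_decode_eq_sum ha hb e x)

end Atoms

section Programs

/-- Total correctness with a time bound: started in the state `s`, the program `P` halts after at
most `T` steps in a state which satisfies `Q`. -/
def HaltsIn (P : Program) (s : State) (T : ℕ) (Q : State → Prop) : Prop :=
  ∃ s' t, Exec P s s' t ∧ t ≤ T ∧ Q s'

theorem HaltsIn.mono {P : Program} {s : State} {T T' : ℕ} {Q Q' : State → Prop}
    (h : HaltsIn P s T Q) (hT : T ≤ T') (hQ : ∀ s', Q s' → Q' s') : HaltsIn P s T' Q' :=
  let ⟨s', t, hP, ht, hs'⟩ := h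
  ⟨s', t, hP, ht.trans hT, hQ s' hs'⟩

/-- The natural number arrays to which a program writes. -/
def Program.natWrites : Program → List ℕ
  | .skip => []
  | .setNat k _ _ => [k]
  | .setReal _ _ _ => []
  | .seq P Q => P.natWrites ++ Q.natWrites
  | .cond _ P Q => P.natWrites ++ Q.natWrites
  | .loop _ P => P.natWrites

/-- The real arrays to which a program writes. -/
def Program.realWrites : Program → List ℕ
  | .skip => []
  | .setNat _ _ _ => []
  | .setReal k _ _ => [k]
  | .seq P Q => P.realWrites ++ Q.realWrites
  | .cond _ P Q => P.realWrites ++ Q.realWrites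
  | .loop _ P => P.realWrites

/-- The states `s` and `s'` agree on all arrays to which `P` does not write. -/
structure Frame (P : Program) (s s' : State) : Prop where
  nat : ∀ k ∉ P.natWrites, s'.nat k = s.nat k
  real : ∀ k ∉ P.realWrites, s'.real k = s.real k

theorem Frame.refl (P : Program) (s : State) : Frame P s s := ⟨fun _ _ => rfl, fun _ _ => rfl⟩

theorem Frame.trans {P : Program} {s s' s'' : State} (h : Frame P s s') (h' : Frame P s' s'') :
    Frame P s s'' :=
  ⟨fun k hk => (h'.nat k hk).trans (h.nat k hk), fun k hk => (h'.real k hk).trans (h.real k hk)⟩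

theorem Frame.mono {P R : Program} {s s' : State} (h : Frame P s s')
    (hnat : P.natWrites ⊆ R.natWrites) (hreal : P.realWrites ⊆ R.realWrites) : Frame R s s' :=
  ⟨fun k hk => h.nat k fun hk' => hk (hnat hk'), fun k hk => h.real k fun hk' => hk (hreal hk')⟩

theorem frame_setNat {P : Program} {k : ℕ} (hk : k ∈ P.natWrites) (s : State) (i v : ℕ) :
    Frame P s (s.setNat k i v) where
  nat _ hk' := funext fun _ => if_neg fun ⟨h, _⟩ => hk' (h ▸ hk)
  real _ _ := rfl

theorem frame_setReal {P : Program} {k : ℕ} (hk : k ∈ P.realWrites) (s : State) (i : ℕ) (v : ℝ) :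
    Frame P s (s.setReal k i v) where
  nat _ _ := rfl
  real _ hk' := funext fun _ => if_neg fun ⟨h, _⟩ => hk' (h ▸ hk)

theorem Exec.frame {P : Program} {s s' : State} {t : ℕ} (h : Exec P s s' t) : Frame P s s' := by
  induction h with
  | skip | loopFalse => exact .refl _ _
  | setNat => exact frame_setNat (List.mem_singleton_self _) ..
  | setReal => exact frame_setReal (List.mem_singleton_self _) ..
  | seq _ _ ih ih' =>
    exact (ih.mono (List.subset_append_left _ _) (List.subset_append_left _ _)).trans
      (ih'.mono (List.subset_append_right _ _) (List.subset_append_right _ _))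
  | condTrue _ _ ih => exact ih.mono (List.subset_append_left _ _) (List.subset_append_left _ _)
  | condFalse _ _ ih => exact ih.mono (List.subset_append_right _ _) (List.subset_append_right _ _)
  | loopTrue _ _ _ ih ih' => exact (show Frame (.loop _ _) _ _ from ⟨ih.nat, ih.real⟩).trans ih'

theorem HaltsIn.frame {P : Program} {s : State} {T : ℕ} {Q : State → Prop}
    (h : HaltsIn P s T Q) : HaltsIn P s T fun s' => Frame P s s' ∧ Q s' :=
  let ⟨s', t, hP, ht, hs'⟩ := h
  ⟨s', t, hP, ht, hP.frame, hs'⟩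

theorem HaltsIn.seq {P R : Program} {s : State} {T T' : ℕ} {Q Q' : State → Prop}
    (hP : HaltsIn P s T Q) (hR : ∀ s', Frame P s s' → Q s' → HaltsIn R s' T' Q') :
    HaltsIn (.seq P R) s (T + T') Q' := by
  obtain ⟨s', t, hP, ht, hs'⟩ := hP
  obtain ⟨s'', t', hR, ht', hs''⟩ := hR s' hP.frame hs'
  exact ⟨s'', t + t', .seq hP hR, add_le_add ht ht', hs''⟩

/-- Programs without loops. -/
def Program.loopFree : Program → Bool
  | .seq P Q => P.loopFree && Q.loopFree
  | .cond _ P Q => P.loopFree && Q.loopFree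
  | .loop _ _ => false
  | _ => true

/-- A bound for the running time of a program without loops. -/
def Program.time : Program → ℕ
  | .skip => 1
  | .setNat _ i e => i.cost + e.cost + 1
  | .setReal _ i e => i.cost + e.cost + 1
  | .seq P Q => P.time + Q.time
  | .cond b P Q => b.cost + max P.time Q.time
  | .loop _ _ => 0

open Classical in
/-- The effect of a program without loops on the memory. -/
noncomputable def Program.run : Program → State → State
  | .skip, s => s
  | .setNat k i e, s => s.setNat k (i.eval s) (e.eval s)
  | .setReal k i e, s => s.setReal k (i.eval s) (e.eval s)
  | .seq P Q, s => Q.run (P.run s)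
  | .cond b P Q, s => if b.holds s then P.run s else Q.run s
  | .loop _ _, s => s

theorem Program.exec_run {P : Program} (hP : P.loopFree) (s : State) :
    ∃ t ≤ P.time, Exec P s (P.run s) t := by
  induction P generalizing s with
  | skip => exact ⟨1, le_rfl, .skip s⟩
  | setNat k i e => exact ⟨_, le_rfl, .setNat k i e s⟩
  | setReal k i e => exact ⟨_, le_rfl, .setReal k i e s⟩
  | seq P Q ihP ihQ =>
    obtain ⟨hP, hQ⟩ := Bool.and_eq_true_iff.1 hP
    obtain ⟨t, ht, h⟩ := ihP hP s
    obtain ⟨t', ht', h'⟩ := ihQ hQ (P.run s)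
    exact ⟨t + t', add_le_add ht ht', .seq h h'⟩
  | cond b P Q ihP ihQ =>
    obtain ⟨hP, hQ⟩ := Bool.and_eq_true_iff.1 hP
    rw [run]
    split_ifs with hb
    · obtain ⟨t, ht, h⟩ := ihP hP s
      exact ⟨b.cost + t, Nat.add_le_add_left (le_max_of_le_left ht) _, .condTrue hb h⟩
    · obtain ⟨t, ht, h⟩ := ihQ hQ s
      exact ⟨b.cost + t, Nat.add_le_add_left (le_max_of_le_right ht) _, .condFalse hb h⟩
  | loop => cases hP

theorem haltsIn_of_loopFree {P : Program} {s : State} {T : ℕ} {Q : State → Prop}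
    (hP : P.loopFree) (hT : P.time ≤ T) (hQ : Q (P.run s)) : HaltsIn P s T Q :=
  let ⟨t, ht, h⟩ := P.exec_run hP s
  ⟨_, t, h, ht.trans hT, hQ⟩

/-- The first entry of the array `k`, used as a variable. -/
abbrev NatExp.var (k : ℕ) : NatExp := .get k (.lit 0)

/-- Assignment to the variable `NatExp.var k`. -/
abbrev Program.assign (k : ℕ) (e : NatExp) : Program := .setNat k (.lit 0) e

/-- The loop `for c from 0 to N - 1 do P`, where `N` is the entry of the array `k` at `l`. -/
def Program.forTo (c k l : ℕ) (P : Program) : Program :=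
  .seq (assign c (.lit 0)) <| .loop (.natLt (.var c) (.get k (.lit l))) <|
    .seq P (assign c (.add (.var c) (.lit 1)))

theorem haltsIn_loop {b : Test} {P : Program} {T : ℕ} (I : ℕ → State → Prop) (N : ℕ)
    (htrue : ∀ i < N, ∀ s, I i s → b.holds s) (hfalse : ∀ s, I N s → ¬ b.holds s)
    (hstep : ∀ i < N, ∀ s, I i s → HaltsIn P s T (I (i + 1))) {s : State} (h : I 0 s) :
    HaltsIn (.loop b P) s (N * (b.cost + T) + b.cost) (I N) := by
  suffices key : ∀ d i, i + d = N → ∀ s, I i s →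
      HaltsIn (.loop b P) s (d * (b.cost + T) + b.cost) (I N) from key N 0 (zero_add N) s h
  intro d
  induction d with
  | zero =>
    rintro i rfl s hs
    exact ⟨s, b.cost, .loopFalse (hfalse s hs), by omega, hs⟩
  | succ d ih =>
    intro i hi s hs
    obtain ⟨s', t, hP, ht, hs'⟩ := hstep i (by omega) s hs
    obtain ⟨s'', t', hloop, ht', hs''⟩ := ih (i + 1) (by omega) s' hs'
    refine ⟨s'', b.cost + t + t', .loopTrue (htrue i (by omega) s hs) hP hloop, ?_, hs''⟩
    rw [Nat.succ_mul]
    omega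

theorem haltsIn_forTo {c k l N T : ℕ} {P : Program} {s : State} (I : ℕ → State → Prop)
    (hN : s.nat k l = N) (hck : k ≠ c) (hc : c ∉ P.natWrites) (hk : k ∉ P.natWrites)
    (hI : ∀ i s v, I i s → I i (s.setNat c 0 v)) (h0 : I 0 s)
    (hstep : ∀ i < N, ∀ s', Frame (.forTo c k l P) s s' → s'.nat c 0 = i → I i s' →
      HaltsIn P s' T (I (i + 1))) :
    HaltsIn (.forTo c k l P) s (N * (T + 11) + 8) (I N) := by
  let J i s' := Frame (.forTo c k l P) s s' ∧ s'.nat c 0 = i ∧ I i s'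
  have hbound {i s'} (h : J i s') : s'.nat k l = N := by
    rw [h.1.nat k (by simp [Program.forTo, Program.natWrites, hck, hk]), hN]
  have hcw : c ∈ (Program.forTo c k l P).natWrites := List.mem_append_left _ (.head _)
  have hinit : HaltsIn (.assign c (.lit 0)) s 3 (J 0) :=
    haltsIn_of_loopFree rfl le_rfl ⟨frame_setNat hcw .., if_pos ⟨rfl, rfl⟩, hI 0 s 0 h0⟩
  have hbody : ∀ i < N, ∀ s', J i s' →
      HaltsIn (.seq P (.assign c (.add (.var c) (.lit 1)))) s' (T + 6) (J (i + 1)) := by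
    rintro i hi s₁ ⟨hf, hci, hIi⟩
    refine (hstep i hi s₁ hf hci hIi).seq fun s₂ hP hs₂ => haltsIn_of_loopFree rfl le_rfl ?_
    have hci₂ : s₂.nat c 0 = i := by rw [hP.nat c hc, hci]
    refine ⟨(hf.trans (hP.mono ?_ ?_)).trans (frame_setNat hcw ..),
      (if_pos ⟨rfl, rfl⟩).trans (congrArg (· + 1) hci₂), hI _ _ _ hs₂⟩ <;>
    simp [Program.forTo, Program.natWrites, Program.realWrites]
  refine (hinit.seq fun s' _ hs' => haltsIn_loop J N ?_ ?_ hbody hs').mono ?_ fun _ h => h.2.2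
  · intro i hi s' h
    change s'.nat c 0 < s'.nat k l
    rwa [h.2.1, hbound h]
  · intro s' h
    change ¬ s'.nat c 0 < s'.nat k l
    rw [h.2.1, hbound h]
    exact lt_irrefl N
  · simp only [Test.cost, NatExp.cost]
    lia

end Programs

namespace Arr

/-! Arrays of natural numbers; `sizes` and `word` are those of `inputState`. -/
abbrev sizes : ℕ := 0
abbrev word : ℕ := 1
abbrev power : ℕ := 2
abbrev quot : ℕ := 3
abbrev rem : ℕ := 4
abbrev index : ℕ := 5
abbrev rest : ℕ := 6
abbrev height : ℕ := 7
abbrev stack : ℕ := 8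
abbrev round : ℕ := 9
abbrev record : ℕ := 10
abbrev recordDigits : ℕ := 11
abbrev outcome : ℕ := 12
abbrev outcomeDigits : ℕ := 13
abbrev next : ℕ := 14

/-! Arrays of real numbers; `table` is that of `inputState`, and `answer` receives the output. -/
abbrev table : ℕ := 0
abbrev answer : ℕ := 1
abbrev leave : ℕ := 2
abbrev gain : ℕ := 3

end Arr

section Algorithm

open Arr

attribute [local simp] Program.run NatExp.eval RealExp.eval Test.holds State.setNat State.setReal

/-- Four times `e`; the machine has no multiplication of natural numbers. -/
abbrev NatExp.fourTimes (e : NatExp) : NatExp := .add (.add e e) (.add e e)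

/-- Computes `4 ^ n`. -/
def powerProg : Program :=
  .seq (.assign power (.lit 1)) <| .forTo index sizes 0 <|
    .assign power (.fourTimes (.var power))

theorem haltsIn_powerProg {n : ℕ} {s : State} (hn : s.nat sizes 0 = n) :
    HaltsIn powerProg s (n * 24 + 11) fun s' => s'.nat power 0 = 4 ^ n := by
  refine HaltsIn.mono (.seq (haltsIn_of_loopFree (T := 3) (Q := fun s' => s'.nat power 0 = 1)
    rfl le_rfl rfl) fun s' hf hs' => haltsIn_forTo (T := 13) (fun i s' => s'.nat power 0 = 4 ^ i)
      ?_ (by decide) (by decide) (by decide) (fun _ _ _ h => h) hs' ?_) (by lia) fun _ h => h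
  · rw [hf.nat sizes (by decide), hn]
  · intro i _ s'' _ _ h
    refine haltsIn_of_loopFree rfl le_rfl ?_
    change s''.nat power 0 + s''.nat power 0 + (s''.nat power 0 + s''.nat power 0) = _
    rw [h, pow_succ]
    ring

/-- Tabulates quotients and remainders modulo 4; the machine has no division of natural numbers. -/
def tableProg : Program :=
  .seq (.seq (.setNat rem (.lit 1) (.lit 1)) <| .seq (.setNat rem (.lit 2) (.lit 2))
    (.setNat rem (.lit 3) (.lit 3))) <|
  .forTo index power 0 <|
  .seq (.setNat quot (.add (.var index) (.lit 4)) (.add (.get quot (.var index)) (.lit 1)))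
    (.setNat rem (.add (.var index) (.lit 4)) (.get rem (.var index)))

theorem haltsIn_tableProg {N : ℕ} {s : State} (hN : s.nat power 0 = N)
    (hquot : ∀ j < 4, s.nat quot j = 0) (hrem : s.nat rem 0 = 0) :
    HaltsIn tableProg s (N * 31 + 20) fun s' =>
      ∀ j < N, s'.nat quot j = j / 4 ∧ s'.nat rem j = j % 4 := by
  let I k (s' : State) := ∀ j < k + 4, s'.nat quot j = j / 4 ∧ s'.nat rem j = j % 4
  refine HaltsIn.mono (.seq (haltsIn_of_loopFree (T := 9) (Q := I 0) rfl le_rfl ?_) fun s' hf hs' =>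
    haltsIn_forTo (N := N) (T := 18) I ?_ (by decide) (by decide) (by decide) (fun _ _ _ h => h)
      hs' ?_) (by lia) fun _ h j hj => h j (by omega)
  · intro j hj
    interval_cases j <;> simp [hquot, hrem]
  · rw [hf.nat power (by decide), hN]
  · intro k _ s'' _ hk h
    refine haltsIn_of_loopFree rfl le_rfl fun j hj => ?_
    obtain hj | rfl := Nat.lt_succ_iff_lt_or_eq.1 (show j < k + 4 + 1 by omega)
    · simp [h j hj, hk, hj.ne]
    · simp [h k (by omega), hk]

/-- The state holds the input and the tables of the algorithm. -/
structure Ready {n : ℕ} (e : FlatExpr (Fin n)) (p : ℕ → ℝ) (s : State) : Prop where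
  arity : s.nat sizes 0 = n
  wordLength : s.nat sizes 1 = e.word.length
  word_eq : ∀ i, s.nat word i = e.word.getD i 0
  table_eq : ∀ j < 4 ^ n, s.real table j = p j
  power_eq : s.nat power 0 = 4 ^ n
  quot_eq : ∀ j < 4 ^ n, s.nat quot j = j / 4
  rem_eq : ∀ j < 4 ^ n, s.nat rem j = j % 4

theorem Ready.frame {n : ℕ} {e : FlatExpr (Fin n)} {p : ℕ → ℝ} {P : Program} {s s' : State}
    (h : Ready e p s) (hf : Frame P s s')
    (hnat : ∀ k ∈ [sizes, word, power, quot, rem], k ∉ P.natWrites := by decide)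
    (hreal : table ∉ P.realWrites := by decide) : Ready e p s' := by
  simp only [List.forall_mem_cons] at hnat
  obtain ⟨hsizes, hword, hpower, hquot, hrem, -⟩ := hnat
  constructor
  · rw [hf.nat _ hsizes]; exact h.arity
  · rw [hf.nat _ hsizes]; exact h.wordLength
  · rw [hf.nat _ hword]; exact h.word_eq
  · rw [hf.real _ hreal]; exact h.table_eq
  · rw [hf.nat _ hpower]; exact h.power_eq
  · rw [hf.nat _ hquot]; exact h.quot_eq
  · rw [hf.nat _ hrem]; exact h.rem_eq

/-- Writes the base four digits of the variable `src` to the array `dst`. -/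
def digitsProg (src dst : ℕ) : Program :=
  .seq (.assign rest (.var src)) <| .forTo index sizes 0 <|
  .seq (.setNat dst (.var index) (.get rem (.var rest)))
    (.assign rest (.get quot (.var rest)))

theorem haltsIn_digitsProg {n x src dst : ℕ} {e : FlatExpr (Fin n)} {p : ℕ → ℝ} {s : State}
    (hs : Ready e p s) (hdst : ∀ k ∈ [sizes, word, power, quot, rem, index, rest], k ≠ dst)
    (hx : x < 4 ^ n) (hsrc : s.nat src 0 = x) :
    HaltsIn (digitsProg src dst) s (n * 22 + 12) fun s' => ∀ i < n, s'.nat dst i = digit x i := by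
  have hindex : dst ≠ index := (hdst index (by decide)).symm
  have hrest : dst ≠ rest := (hdst rest (by decide)).symm
  simp only [List.forall_mem_cons] at hdst
  let I k (s' : State) := s'.nat rest 0 = x / 4 ^ k ∧ ∀ i < k, s'.nat dst i = digit x i
  refine HaltsIn.mono (.seq (haltsIn_of_loopFree (T := 4) (Q := I 0) rfl le_rfl ?_) fun s' hf hs' =>
    haltsIn_forTo (N := n) (T := 11) I ?_ (by decide) ?_ ?_ ?_ hs' ?_) (by lia) fun _ h => h.2
  · exact ⟨by simp [hsrc], fun _ h => absurd h (Nat.not_lt_zero _)⟩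
  · rw [hf.nat sizes (by simp [Program.natWrites]), hs.arity]
  · simp [Program.natWrites, hdst]
  · simp [Program.natWrites, hdst]
  · intro k s' v h
    simpa [I, hindex] using h
  · rintro k hk s'' hf' hcounter ⟨hquotient, hdigits⟩
    have hs'' : Ready e p s'' := (hs.frame hf (by simp [Program.natWrites])
      (by simp [Program.realWrites])).frame hf'
      (by simp [Program.natWrites, Program.forTo, hdst])
      (by simp [Program.realWrites, Program.forTo])
    have hlt : x / 4 ^ k < 4 ^ n := (Nat.div_le_self _ _).trans_lt hx
    refine haltsIn_of_loopFree rfl le_rfl ⟨?_, fun i hi => ?_⟩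
    · simp [hdst, hquotient, hs''.quot_eq _ hlt, Nat.div_div_eq_div_mul, pow_succ]
    · obtain hi | rfl := Nat.lt_succ_iff_lt_or_eq.1 hi
      · simp [hrest, hdigits i hi, hcounter, hi.ne]
      · simp [hrest, hs''.rem_eq _ hlt, digit, hcounter, hquotient]

/-- Computes the code `step n x j` from the digits of `x` and `j`, starting with the leading one.
With truncated subtraction, `d + (d' - d)` is the maximum of `d` and `d'`. -/
def stepProg : Program :=
  let place : NatExp := .sub (.sub (.var sizes) (.lit 1)) (.var index)
  let d : NatExp := .get recordDigits place
  let d' : NatExp := .get outcomeDigits place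
  .seq (.assign next (.lit 0)) <| .forTo index sizes 0 <|
  .cond (.natLt d (.lit 2))
    (.assign next (.add (.fourTimes (.var next)) (.add d (.sub d' d))))
    (.assign next (.add (.fourTimes (.var next)) d))

theorem haltsIn_stepProg {n x j : ℕ} {e : FlatExpr (Fin n)} {p : ℕ → ℝ} {s : State}
    (hs : Ready e p s) (hx : ∀ i < n, s.nat recordDigits i = digit x i)
    (hj : ∀ i < n, s.nat outcomeDigits i = digit j i) :
    HaltsIn stepProg s (n * 61 + 11) fun s' => s'.nat next 0 = step n x j := by
  let I k (s' : State) := s'.nat next 0 = step n x j / 4 ^ (n - k)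
  refine HaltsIn.mono (.seq (haltsIn_of_loopFree (T := 3) (Q := I 0) rfl le_rfl ?_) fun s' hf hs' =>
    haltsIn_forTo (N := n) (T := 50) I ?_ (by decide) (by decide) (by decide) (fun _ _ _ h => h)
      hs' ?_) (by lia) fun s' (h : I n s') => ?_
  · exact (Nat.div_eq_of_lt (step_lt n x j)).symm
  · rw [hf.nat sizes (by decide), hs.arity]
  · intro k hk s'' hf' hcounter (hnext : _ = _)
    have hframe := (hf.mono (R := stepProg) (by decide) (by decide)).trans
      (hf'.mono (R := stepProg) (by decide) (by decide))
    have harity : s''.nat sizes 0 = n := by rw [hframe.nat sizes (by decide), hs.arity]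
    have hd : s''.nat recordDigits (n - 1 - k) = digit x (n - 1 - k) := by
      rw [hframe.nat recordDigits (by decide), hx _ (by omega)]
    have hd' : s''.nat outcomeDigits (n - 1 - k) = digit j (n - 1 - k) := by
      rw [hframe.nat outcomeDigits (by decide), hj _ (by omega)]
    refine haltsIn_of_loopFree rfl (by decide) ?_
    have hdigit := digit_step (n := n) x j ⟨n - 1 - k, by omega⟩
    have hstep := four_mul_div_pow_succ_add_digit (step n x j) (n - 1 - k)
    rw [show n - 1 - k + 1 = n - k by omega, hdigit] at hstep
    change _ = step n x j / 4 ^ (n - (k + 1))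
    rw [show n - (k + 1) = n - 1 - k by omega, ← hstep, stepDigit]
    simp only [Program.run, Test.holds, NatExp.eval, harity, hcounter, hd, hd', hnext]
    split_ifs <;> simp only [State.setNat, and_self, if_true] <;> omega
  · rw [h, Nat.sub_self, pow_zero, Nat.div_one]

theorem FlatExpr.length_word {n : ℕ} (e : FlatExpr (Fin n)) : e.word.length = e.length := by
  induction e <;> simp [FlatExpr.word, FlatExpr.length, add_assoc, *]

/-- The effect of a letter of a word in reverse Polish notation on a stack, which is given by its
height and its entries, if `v i` is the value of the letter `i + 3`. The value of a conjunction or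
disjunction is expressed by truncated subtractions. -/
def letterStep (v : ℕ → ℕ) : ℕ × (ℕ → ℕ) → ℕ → ℕ × (ℕ → ℕ)
  | (h, m), 0 => (h, Function.update m (h - 1) (1 - m (h - 1)))
  | (h, m), 1 => (h - 1, Function.update m (h - 1 - 1) (m (h - 1 - 1) + m (h - 1) - 1))
  | (h, m), 2 => (h - 1, Function.update m (h - 1 - 1) (1 - (1 - (m (h - 1 - 1) + m (h - 1)))))
  | (h, m), i + 3 => (h + 1, Function.update m h (v i))

theorem foldl_letterStep_word {n : ℕ} {v : ℕ → ℕ} {b : Fin n → Bool}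
    (hv : ∀ i : Fin n, v i = (b i).toNat) (e : FlatExpr (Fin n)) (h : ℕ) (m : ℕ → ℕ) :
    ∃ m', e.word.foldl (letterStep v) (h, m) = (h + 1, m') ∧ m' h = (e.eval b).toNat ∧
      ∀ i < h, m' i = m i := by
  induction e generalizing h m with
  | simple i =>
    exact ⟨_, rfl, (Function.update_self ..).trans (hv i),
      fun k hk => Function.update_of_ne hk.ne _ _⟩
  | neg e ih =>
    obtain ⟨m', hm', htop, hbelow⟩ := ih h m
    refine ⟨_, by rw [FlatExpr.word, List.foldl_append, hm']; rfl, ?_, fun k hk => ?_⟩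
    · simp only [Nat.add_sub_cancel, Function.update_self, htop, FlatExpr.eval]
      cases e.eval b <;> rfl
    · rw [← hbelow k hk]
      exact Function.update_of_ne hk.ne _ _
  | and e f ih ih' | or e f ih ih' =>
    obtain ⟨m', hm', htop, hbelow⟩ := ih h m
    obtain ⟨m'', hm'', htop', hbelow'⟩ := ih' (h + 1) m'
    refine ⟨_, by rw [FlatExpr.word, List.foldl_append, List.foldl_append, hm', hm'']; rfl, ?_,
      fun k hk => ?_⟩
    · simp only [Nat.add_sub_cancel, Function.update_self, htop, htop', hbelow' h h.lt_succ_self,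
        FlatExpr.eval]
      cases e.eval b <;> cases f.eval b <;> rfl
    · rw [← hbelow k hk, ← hbelow' k (hk.trans h.lt_succ_self)]
      exact Function.update_of_ne hk.ne _ _

/-- Performs `letterStep` for the letter at `index`. -/
def letterProg : Program :=
  let letter : NatExp := .get word (.var index)
  let pop : Program := .assign height (.sub (.var height) (.lit 1))
  let top : NatExp := .sub (.var height) (.lit 1)
  let sum : NatExp := .add (.get stack top) (.get stack (.var height))
  .cond (.natEq letter (.lit 0)) (.setNat stack top (.sub (.lit 1) (.get stack top))) <|
  .cond (.natEq letter (.lit 1)) (.seq pop (.setNat stack top (.sub sum (.lit 1)))) <|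
  .cond (.natEq letter (.lit 2))
    (.seq pop (.setNat stack top (.sub (.lit 1) (.sub (.lit 1) sum))))
    (.seq (.setNat stack (.var height) (.sub (.get recordDigits (.sub letter (.lit 3))) (.lit 2)))
      (.assign height (.add (.var height) (.lit 1))))

theorem haltsIn_letterProg {s : State} {l i : ℕ} (hi : s.nat index 0 = i)
    (hl : s.nat word i = l) : HaltsIn letterProg s 50 fun s' =>
      (s'.nat height 0, s'.nat stack) =
        letterStep (fun i => s.nat recordDigits i - 2) (s.nat height 0, s.nat stack) l := by
  refine haltsIn_of_loopFree rfl (by decide) ?_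
  obtain _ | _ | _ | l := l <;>
    simp [letterProg, letterStep, hi, hl, funext_iff, Function.update_apply]

/-- Leaves the truth value of the expression after the record in the lowest entry of the stack. -/
def evalProg : Program :=
  .seq (.assign height (.lit 0)) <| .forTo index sizes 1 letterProg

theorem haltsIn_evalProg {n x : ℕ} {e : FlatExpr (Fin n)} {p : ℕ → ℝ} {s : State}
    (hs : Ready e p s) (hx : ∀ i < n, s.nat recordDigits i = digit x i) :
    HaltsIn evalProg s (e.length * 61 + 11) fun s' =>
      s'.nat stack 0 = (e.eval fun i => (decode n x i).getD false).toNat := by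
  let v i := s.nat recordDigits i - 2
  have hv (i : Fin n) : v i = ((decode n x i).getD false).toNat := by
    have hlt := digit_lt x i
    simp only [v, hx i i.is_lt, decode]
    interval_cases digit x i <;> rfl
  let I k (s' : State) := (s'.nat height 0, s'.nat stack) =
    (e.word.take k).foldl (letterStep v) (0, s.nat stack)
  refine HaltsIn.mono (.seq (haltsIn_of_loopFree (T := 3) (Q := I 0) rfl le_rfl ?_) fun s' hf hs' =>
    haltsIn_forTo (N := e.length) (T := 50) I ?_ (by decide) (by decide) (by decide)
      (fun _ _ _ h => h) hs' ?_) (by lia) fun s' (h : I e.length s') => ?_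
  · rfl
  · rw [hf.nat sizes (by decide), hs.wordLength, e.length_word]
  · intro k hk s'' hf' hcounter (hstack : _ = _)
    have hframe := (hf.mono (R := evalProg) (by decide) (by decide)).trans
      (hf'.mono (R := evalProg) (by decide) (by decide))
    have hk : k < e.word.length := e.length_word.symm ▸ hk
    have hletter : s''.nat word k = e.word[k] := by
      rw [hframe.nat word (by decide), hs.word_eq, List.getD_eq_getElem _ _ hk]
    refine (haltsIn_letterProg hcounter hletter).mono le_rfl fun s₃ h => h.trans ?_
    rw [List.take_succ_eq_append_getElem hk, List.foldl_append, ← hstack,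
      hframe.nat recordDigits (by decide)]
    rfl
  · obtain ⟨m', hm', htop, -⟩ := foldl_letterStep_word hv e 0 (s.nat stack)
    have h : (s'.nat height 0, s'.nat stack) = (1, m') := by
      rw [h, ← e.length_word, List.take_length, hm']
    exact (congrFun (Prod.ext_iff.1 h).2 0).trans htop

variable {n x : ℕ} {e : FlatExpr (Fin n)} {p F : ℕ → ℝ} {s : State}

/-- The state at which the record `x` is processed: its digits are known, and so are the values of
`F` at the larger records. -/
structure AtRecord (n x : ℕ) (F : ℕ → ℝ) (s : State) : Prop where
  record_lt : x < 4 ^ n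
  record_eq : s.nat record 0 = x
  digits_eq : ∀ i < n, s.nat recordDigits i = digit x i
  answer_eq : ∀ y, x < y → y < 4 ^ n → s.real answer y = F y

theorem AtRecord.frame {P : Program} {s' : State} (h : AtRecord n x F s) (hf : Frame P s s')
    (hrecord : record ∉ P.natWrites := by decide)
    (hdigits : recordDigits ∉ P.natWrites := by decide)
    (hanswer : answer ∉ P.realWrites := by decide) : AtRecord n x F s' where
  record_lt := h.record_lt
  record_eq := by rw [hf.nat _ hrecord]; exact h.record_eq
  digits_eq := by rw [hf.nat _ hdigits]; exact h.digits_eq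
  answer_eq := by rw [hf.real _ hanswer]; exact h.answer_eq

/-- Adds the contributions of an atom to the sums in `IsSolution`. -/
def atomProg : Program :=
  .seq (digitsProg outcome outcomeDigits) <| .seq stepProg <|
  .cond (.natEq (.var next) (.var record)) .skip <|
  .seq (.setReal leave (.lit 0) (.add (.get leave (.lit 0)) (.get table (.var outcome))))
    (.setReal gain (.lit 0) (.add (.get gain (.lit 0))
      (.mul (.get table (.var outcome)) (.get answer (.var next)))))

theorem haltsIn_atomProg {j : ℕ} (hs : Ready e p s) (hx : AtRecord n x F s) (hj : j < 4 ^ n)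
    (houtcome : s.nat outcome 0 = j) : HaltsIn atomProg s (n * 83 + 60) fun s' =>
      s'.real leave 0 = s.real leave 0 + (if step n x j = x then 0 else p j) ∧
      s'.real gain 0 = s.real gain 0 + if step n x j = x then 0 else p j * F (step n x j) := by
  refine HaltsIn.mono (.seq (haltsIn_digitsProg hs (by decide) hj houtcome) fun s₁ hf₁ hdigits =>
    .seq (haltsIn_stepProg (hs.frame hf₁) (hx.frame hf₁).digits_eq hdigits) fun s₂ hf₂ hnext =>
    haltsIn_of_loopFree (T := 37) rfl (by decide) ?_) (by lia) fun _ h => h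
  have hrecord₂ : s₂.nat record 0 = x := ((hx.frame hf₁).frame hf₂).record_eq
  have houtcome₂ : s₂.nat outcome 0 = j := by
    rw [hf₂.nat outcome (by decide), hf₁.nat outcome (by decide), houtcome]
  have hreal : s₂.real = s.real := by
    funext k
    rw [hf₂.real k List.not_mem_nil, hf₁.real k List.not_mem_nil]
  by_cases hstep : step n x j = x
  · simp [hnext, hrecord₂, hstep, hreal]
  · have hlt : x < step n x j := lt_of_le_of_ne (le_step hx.record_lt j) (Ne.symm hstep)
    simp [hnext, hrecord₂, hstep, houtcome₂, hs.table_eq j hj, hreal,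
      hx.answer_eq _ hlt (step_lt n x j)]

/-- Computes the two sums over the atoms in `IsSolution`. -/
def sumsProg : Program :=
  .seq (.seq (.setReal leave (.lit 0) .zero) (.setReal gain (.lit 0) .zero)) <|
  .forTo outcome power 0 atomProg

theorem haltsIn_sumsProg (hs : Ready e p s) (hx : AtRecord n x F s) :
    HaltsIn sumsProg s (4 ^ n * (n * 83 + 71) + 14) fun s' => s'.real leave 0 = leaveProb n p x ∧
      s'.real gain 0 = ∑ j ∈ Finset.range (4 ^ n),
        if step n x j = x then 0 else p j * F (step n x j) := by
  let I k (s' : State) :=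
    s'.real leave 0 = ∑ j ∈ Finset.range k, (if step n x j = x then 0 else p j) ∧
    s'.real gain 0 = ∑ j ∈ Finset.range k, if step n x j = x then 0 else p j * F (step n x j)
  refine HaltsIn.mono (.seq (haltsIn_of_loopFree (T := 6) (Q := I 0) rfl le_rfl ?_) fun s' hf hs' =>
    haltsIn_forTo (N := 4 ^ n) (T := n * 83 + 60) I ?_ (by decide) (by decide) (by decide)
      (fun _ _ _ h => h) hs' ?_) (by lia) fun s' h => h
  · simp [I]
  · rw [hf.nat power (by decide), hs.power_eq]
  · intro j hj s'' hf' houtcome ⟨hleave, hgain⟩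
    refine (haltsIn_atomProg ((hs.frame hf).frame hf') ((hx.frame hf).frame hf') hj houtcome).mono
      le_rfl fun s₃ ⟨hleave', hgain'⟩ => ⟨?_, ?_⟩
    · rw [hleave', hleave, Finset.sum_range_succ]
    · rw [hgain', hgain, Finset.sum_range_succ]

/-- Computes the value of a solution at the current record. -/
def valueProg : Program :=
  .seq evalProg <| .seq sumsProg <|
  .cond (.realEq (.get leave (.lit 0)) .zero)
    (.cond (.natEq (.var stack) (.lit 0)) (.setReal answer (.var record) .zero)
      (.setReal answer (.var record) .one))
    (.setReal answer (.var record) (.div (.get gain (.lit 0)) (.get leave (.lit 0))))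

theorem haltsIn_valueProg (hF : IsSolution e p F) (hs : Ready e p s) (hx : AtRecord n x F s) :
    HaltsIn valueProg s (4 ^ n * (n * 83 + 71) + e.length * 61 + 38) fun s' =>
      ∀ y, x ≤ y → y < 4 ^ n → s'.real answer y = F y := by
  refine HaltsIn.mono (.seq (haltsIn_evalProg hs hx.digits_eq) fun s₁ hf₁ heval =>
    .seq (haltsIn_sumsProg (hs.frame hf₁) (hx.frame hf₁)) fun s₂ hf₂ hsums =>
    haltsIn_of_loopFree (T := 13) rfl (by decide) fun y hxy hyn => ?_) (by lia) fun _ h => h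
  obtain ⟨hleave, hgain⟩ := hsums
  have hx₂ : AtRecord n x F s₂ := (hx.frame hf₁).frame hf₂
  have hstack : s₂.nat stack 0 = (e.eval fun i => (decode n x i).getD false).toNat := by
    rw [hf₂.nat stack (by decide), heval]
  obtain rfl | hlt := hxy.eq_or_lt
  · rw [hF x]
    cases heval : e.eval fun i => (decode n x i).getD false <;>
      by_cases h : leaveProb n p x = 0 <;>
      simp [hleave, hgain, hstack, heval, hx₂.record_eq, h]
  · by_cases h : leaveProb n p x = 0 <;>
    by_cases h' : s₂.nat stack 0 = 0 <;>
    simp [hleave, h, h', hx₂.record_eq, hlt.ne', hx₂.answer_eq y hlt hyn]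

/-- Computes the value of a solution at the record whose code is followed by `round` codes. -/
def recordProg : Program :=
  .seq (.assign record (.sub (.sub (.var power) (.lit 1)) (.var round))) <|
  .seq (digitsProg record recordDigits) valueProg

theorem haltsIn_recordProg {k : ℕ} (hF : IsSolution e p F) (hs : Ready e p s) (hk : k < 4 ^ n)
    (hround : s.nat round 0 = k) (hans : ∀ y, 4 ^ n - k ≤ y → y < 4 ^ n → s.real answer y = F y) :
    HaltsIn recordProg s (4 ^ n * (n * 83 + 71) + n * 22 + e.length * 61 + 59) fun s' =>
      ∀ y, 4 ^ n - (k + 1) ≤ y → y < 4 ^ n → s'.real answer y = F y := by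
  obtain ⟨x, hx⟩ : ∃ x, x + 1 + k = 4 ^ n := ⟨4 ^ n - 1 - k, by omega⟩
  have hxn : x < 4 ^ n := by omega
  refine HaltsIn.mono (.seq (haltsIn_of_loopFree (T := 9) (Q := fun s' => s'.nat record 0 = x)
      rfl le_rfl ?_) fun s₁ hf₁ hrecord =>
    .seq (haltsIn_digitsProg (hs.frame hf₁) (by decide) hxn hrecord) fun s₂ hf₂ hdigits =>
    haltsIn_valueProg hF ((hs.frame hf₁).frame hf₂) ⟨hxn, ?_, hdigits, fun y hxy hyn => ?_⟩)
    (by lia) fun s' h y hy => h y (by omega)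
  · change s.nat power 0 - 1 - s.nat round 0 = x
    rw [hs.power_eq, hround]
    omega
  · rw [hf₂.nat record (by decide), hrecord]
  · rw [hf₂.real answer (by decide), hf₁.real answer (by decide), hans y (by omega) hyn]

/-- Prepares the tables of the algorithm. -/
def setupProg : Program := .seq powerProg tableProg

theorem haltsIn_setupProg (e : FlatExpr (Fin n)) (p : ℕ → ℝ) :
    HaltsIn setupProg (inputState e p) (4 ^ n * 31 + n * 24 + 31) (Ready e p) := by
  refine HaltsIn.mono (.seq (haltsIn_powerProg (n := n) rfl) fun s₁ hf₁ hpower =>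
    (haltsIn_tableProg hpower (fun j _ => congrFun (hf₁.nat quot (by decide)) j)
      (congrFun (hf₁.nat rem (by decide)) 0)).frame.mono le_rfl fun s₂ ⟨hf₂, htable⟩ => ?_)
    (by lia) fun _ h => h
  constructor
  · rw [hf₂.nat sizes (by decide), hf₁.nat sizes (by decide)]; rfl
  · rw [hf₂.nat sizes (by decide), hf₁.nat sizes (by decide)]; rfl
  · rw [hf₂.nat word (by decide), hf₁.nat word (by decide)]; exact fun _ => rfl
  · rw [hf₂.real table (by decide), hf₁.real table (by decide)]
    exact fun j hj => if_pos ⟨rfl, hj⟩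
  · rw [hf₂.nat power (by decide), hpower]
  · exact fun j hj => (htable j hj).1
  · exact fun j hj => (htable j hj).2

/-- Computes the value of the solution of `IsSolution` at the empty record. -/
def psProg : Program := .seq setupProg <| .forTo round power 0 recordProg

theorem haltsIn_psProg (hF : IsSolution e p F) :
    HaltsIn psProg (inputState e p)
      (4 ^ n * (4 ^ n * (n * 83 + 71) + n * 22 + e.length * 61 + 101) + n * 24 + 39) fun s' =>
      s'.real answer 0 = F 0 := by
  refine HaltsIn.mono (.seq (haltsIn_setupProg e p) fun s₁ _ hs₁ =>
    haltsIn_forTo (N := 4 ^ n) (T := 4 ^ n * (n * 83 + 71) + n * 22 + e.length * 61 + 59)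
      (fun k s' => ∀ y, 4 ^ n - k ≤ y → y < 4 ^ n → s'.real answer y = F y) hs₁.power_eq
      (by decide) (by decide) (by decide) (fun _ _ _ h => h) (fun y _ _ => by omega)
      fun k hk s₂ hf₂ hround hans => haltsIn_recordProg hF (hs₁.frame hf₂) hk hround hans)
    (by lia) fun s' h => h 0 (by omega) (by positivity)

end Algorithm

end PSCond

/-- There are one program and one polynomial such that, for all `n`, all `n`-ary conditional
expressions `e`, all probability spaces and all events `a_i`, `b_i`, the program, given `e` and the
probabilities of the atomic Boolean combinations of the `a_i`, `b_i`, halts with the PS probability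
of `e((a_0 | b_0), …, (a_(n-1) | b_(n-1)))` in the first cell of the real array `1`, in time
polynomial in `max (length of e) (2 ^ n)`. -/
theorem mainTheorem7 :
    ∃ (P : Program) (q : Polynomial ℕ),
      ∀ (n : ℕ) (e : FlatExpr (Fin n)) (Ω : Type*) [MeasurableSpace Ω] (μ : Measure Ω)
        [IsProbabilityMeasure μ] (a b : Fin n → Set Ω),
        (∀ i, MeasurableSet (a i)) → (∀ i, MeasurableSet (b i)) →
        ∃ (s : State) (t : ℕ),
          Exec P (inputState e (fun j => μ.real (atom a b j))) s t ∧
          t ≤ q.eval (max e.length (2 ^ n)) ∧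
          s.real 1 0 = (e.map (fun i => (a i, b i))).psProb μ := by
  refine ⟨psProg, .X ^ 2 * (.X ^ 2 * (.X * 83 + 71) + .X * 22 + .X * 61 + 101) + .X * 24 + 39, ?_⟩
  intro n e Ω _ μ _ a b ha hb
  obtain ⟨s, t, hexec, ht, hanswer⟩ := haltsIn_psProg (isSolution_recordProb (μ := μ) ha hb e)
  rw [decode_zero, recordProb_none] at hanswer
  refine ⟨s, t, hexec, ht.trans ?_, hanswer⟩
  have hlength : e.length ≤ max e.length (2 ^ n) := le_max_left _ _
  have htwo : 2 ^ n ≤ max e.length (2 ^ n) := le_max_right _ _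
  have harity : n ≤ max e.length (2 ^ n) := Nat.lt_two_pow_self.le.trans htwo
  have hfour : 4 ^ n ≤ max e.length (2 ^ n) ^ 2 := by
    rw [show 4 = 2 ^ 2 from rfl, ← pow_mul, mul_comm, pow_mul]
    exact Nat.pow_le_pow_left htwo 2
  generalize max e.length (2 ^ n) = M at *
  simp only [Polynomial.eval_add, Polynomial.eval_mul, Polynomial.eval_pow, Polynomial.eval_X,
    Polynomial.eval_ofNat]
  gcongr
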